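/- There is a universal constant $\kappa$ with the following property. Let $R>0$, let $B_R^+=\{(x,y)\in\mathbb R^2: x^2+y^2<R^2,\ y>0\}$, and let $h\in H^1(B_R^+)$ be real-valued, with weak gradient $\nabla h$. Let $h(\cdot,0)\in L^2((0,R))$ denote the trace of $h$ on the segment $(0,R)\times\{0\}$ of the positive real axis, that is, the limit in $L^2((0,R))$ of $\varphi_n(\cdot,0)$ for functions $\varphi_n\in C^\infty(\mathbb R^2)$ with $\varphi_n\to h$ in $H^1(B_R^+)$. Then this trace exists, $x^{-1/2}h(x,0)$ is integrable on $(0,R)$, and $$\int_0^R x^{-1/2}|h(x,0)|\,dx\le \kappa\left(R\int_{B_R^+}|\nabla h(\boldsymbol x)|^2\,d\boldsymbol x\right)^{1/2}+\kappa\left(\int_0^R h(x,0)^2\,dx\right)^{1/2}.$$ -/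

import Mathlib

open MeasureTheory Set Filter
open scoped ENNReal Topology ContDiff

/-- The open upper half disc of radius `R` centred at the origin of the plane. The plane is `ℝ × ℝ`
with its Lebesgue measure; the disc is written out with the Euclidean norm. -/
def halfDisc (R : ℝ) : Set (ℝ × ℝ) :=
  {p | p.1 ^ 2 + p.2 ^ 2 < R ^ 2 ∧ 0 < p.2}

/-- `h` belongs to the Sobolev space `H¹(U)` and `g` is (a representative of) its weak gradient:
`h` and the components of `g` are in `L²(U)`, and the integration by parts formula holds against all
smooth test functions with compact support in `U`. -/
structure IsH1WithGradient (U : Set (ℝ × ℝ)) (h : ℝ × ℝ → ℝ) (g : ℝ × ℝ → ℝ × ℝ) : Prop where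
  memLp : MemLp h 2 (volume.restrict U)
  memLp_fst : MemLp (fun p => (g p).1) 2 (volume.restrict U)
  memLp_snd : MemLp (fun p => (g p).2) 2 (volume.restrict U)
  weak_fst : ∀ φ : ℝ × ℝ → ℝ, ContDiff ℝ ∞ φ → HasCompactSupport φ → tsupport φ ⊆ U →
    ∫ p in U, h p * fderiv ℝ φ p (1, 0) = -∫ p in U, (g p).1 * φ p
  weak_snd : ∀ φ : ℝ × ℝ → ℝ, ContDiff ℝ ∞ φ → HasCompactSupport φ → tsupport φ ⊆ U →
    ∫ p in U, h p * fderiv ℝ φ p (0, 1) = -∫ p in U, (g p).2 * φ p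

/-- For `h ∈ H¹(U)` with weak gradient `g`, the sequence `φ` of differentiable functions converges to
`h` in `H¹(U)`: the functions and both partial derivatives converge in `L²(U)`. -/
structure TendstoInH1 (U : Set (ℝ × ℝ)) (φ : ℕ → ℝ × ℝ → ℝ) (h : ℝ × ℝ → ℝ)
    (g : ℝ × ℝ → ℝ × ℝ) : Prop where
  fun_tendsto : Tendsto (fun n => eLpNorm (fun p => φ n p - h p) 2 (volume.restrict U)) atTop (𝓝 0)
  fst_tendsto : Tendsto (fun n => eLpNorm (fun p => fderiv ℝ (φ n) p (1, 0) - (g p).1) 2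
    (volume.restrict U)) atTop (𝓝 0)
  snd_tendsto : Tendsto (fun n => eLpNorm (fun p => fderiv ℝ (φ n) p (0, 1) - (g p).2) 2
    (volume.restrict U)) atTop (𝓝 0)

/-- `t ∈ L²((0,R))` is the trace `h(·,0)` on the segment `(0,R) × {0}` of the function
`h ∈ H¹(halfDisc R)` with weak gradient `g`. The trace operator is the continuous extension to `H¹` of
the restriction map on functions that are smooth up to the boundary; so `t` is the limit in
`L²((0,R))` of the restrictions of such functions that converge to `h` in `H¹`. -/
structure IsTraceOnPosAxis (R : ℝ) (h : ℝ × ℝ → ℝ) (g : ℝ × ℝ → ℝ × ℝ) (t : ℝ → ℝ) : Prop where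
  memLp : MemLp t 2 (volume.restrict (Ioo 0 R))
  exists_approx : ∃ φ : ℕ → ℝ × ℝ → ℝ, (∀ n, ContDiff ℝ ∞ (φ n)) ∧
    TendstoInH1 (halfDisc R) φ h g ∧
    Tendsto (fun n => eLpNorm (fun x => φ n (x, 0) - t x) 2 (volume.restrict (Ioo 0 R)))
      atTop (𝓝 0)

/-!
The spaces `H¹` and `L²` are reached from functions that are smooth in the whole plane, for which
three facts are proved.

* Weighted estimate (`lintegral_inv_sqrt_mul_trace_le`). In polar coordinates, each angular
  increment `|u(r,θ) - u(r,0)|` is at most `r ∫ |∇u|` over the arc of radius `r`, and for fixed `θ`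
  integration by parts on the ray against the weight `2√r - 2r/√R`, which vanishes at both ends and
  has derivative `1/√r - 2/√R`, gives
  `∫ r^(-1/2) |u| dr ≤ 2 R^(-1/2) ∫ |u| dr + 2 ∫ √r |∂ᵣu| dr`
  (`integral_inv_sqrt_mul_abs_le`). Passing from the axis to the ray at angle `θ`, applying this
  inequality there, passing back to the axis to control `∫ |u| dr`, and averaging over `θ ∈ (0,1)`,
  every gradient term is bounded by a multiple of `∫∫ √r |∇u| dr dθ`. The area element is `r dr dθ`, so
  by Cauchy–Schwarz this is at most `√R` times the norm of `∇u` in `L²` of the half disc. The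
  remaining term `2 R^(-1/2) ∫ |u(r,0)| dr` is at most twice the norm of the trace in `L²`.
* Trace bound (`eLpNorm_trace_le`). The translates of `(0,R) × {0}` in the direction `(-1,1)` stay
  in the half disc up to height `R/2`. Averaging the fundamental theorem of calculus along these
  oblique segments bounds the norm of the trace in `L²` by the norm in `H¹`.
* Density (`exists_contDiff_tendstoInH1`). The half disc is convex, so composing a mollification
  with a contraction towards an interior point gives smooth functions on the whole plane; at points
  of the half disc only values of `h` inside the half disc are averaged, so that the derivative
  falls on the weak gradient (`fderiv_mollify_of_weak`).

Density and the trace bound make the traces of an approximating sequence a Cauchy sequence, whose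
limit is the trace. For any trace, the weighted estimate passes to the limit by Fatou's lemma along
a subsequence that converges almost everywhere.
-/

open scoped Convolution
open ContinuousLinearMap (lsmul)

/-! ### Square roots of integrals, and the weighted inequality on an interval -/

/-- The Cauchy–Schwarz inequality for the lower integral. -/
theorem lintegral_mul_le_rpow_half {α : Type*} [MeasurableSpace α] (μ : Measure α)
    {f g : α → ℝ≥0∞} (hf : AEMeasurable f μ) (hg : AEMeasurable g μ) :
    ∫⁻ a, f a * g a ∂μ ≤
      (∫⁻ a, f a ^ 2 ∂μ) ^ (1 / 2 : ℝ) * (∫⁻ a, g a ^ 2 ∂μ) ^ (1 / 2 : ℝ) := by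
  simpa using ENNReal.lintegral_mul_le_Lp_mul_Lq μ Real.HolderConjugate.two_two hf hg

theorem eLpNorm_two_eq_rpow_half {α : Type*} [MeasurableSpace α] (μ : Measure α) (f : α → ℝ) :
    eLpNorm f 2 μ = (∫⁻ a, ‖f a‖ₑ ^ 2 ∂μ) ^ (1 / 2 : ℝ) := by
  rw [eLpNorm_eq_lintegral_rpow_enorm_toReal (by norm_num) (by norm_num)]
  simp

theorem sq_rpow_half (a : ℝ≥0∞) : (a ^ (1 / 2 : ℝ)) ^ 2 = a := by
  rw [← ENNReal.rpow_natCast, ← ENNReal.rpow_mul]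
  norm_num

theorem sq_eLpNorm_two {α : Type*} [MeasurableSpace α] (μ : Measure α) (f : α → ℝ) :
    eLpNorm f 2 μ ^ 2 = ∫⁻ a, ‖f a‖ₑ ^ 2 ∂μ := by
  rw [eLpNorm_two_eq_rpow_half, sq_rpow_half]

theorem intervalIntegrable_inv_sqrt (R : ℝ) : IntervalIntegrable (fun r => (√r)⁻¹) volume 0 R := by
  have h := intervalIntegral.intervalIntegrable_rpow' (a := 0) (b := R)
    (r := (-(1 / 2) : ℝ)) (by norm_num)
  apply h.mono_fun (by fun_prop)
  refine Eventually.of_forall fun r => ?_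
  rcases le_or_gt 0 r with hr | hr
  · simp [Real.sqrt_eq_rpow, Real.rpow_neg hr]
  · simp [Real.sqrt_eq_zero_of_nonpos hr.le]

/-- Integration by parts of `|f|` against `2√r - 2r/√R`, which vanishes at `0` and at `R`. The function
`|f|` is replaced by the differentiable function `√(f² + ε²)`, and `ε` tends to `0`. -/
theorem integral_inv_sqrt_mul_abs_le {f : ℝ → ℝ} (hf : ContDiff ℝ 1 f) {R : ℝ} (hR : 0 < R) :
    ∫ r in (0 : ℝ)..R, (√r)⁻¹ * |f r| ≤
      2 / √R * (∫ r in (0 : ℝ)..R, |f r|) + 2 * ∫ r in (0 : ℝ)..R, √r * |deriv f r| := by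
  have hf0 : Continuous f := hf.continuous
  have hf1 : Continuous (deriv f) := hf.continuous_deriv le_rfl
  have hsR : 0 < √R := Real.sqrt_pos.2 hR
  have key : ∀ ε : ℝ, 0 < ε → ∫ r in (0 : ℝ)..R, (√r)⁻¹ * |f r| ≤
      2 / √R * (∫ r in (0 : ℝ)..R, |f r|) + 2 * (∫ r in (0 : ℝ)..R, √r * |deriv f r|)
        + 2 / √R * R * ε := by
    intro ε hε
    set v : ℝ → ℝ := fun r => √(f r ^ 2 + ε ^ 2) with hv
    have hpos : ∀ r, 0 < f r ^ 2 + ε ^ 2 := fun r => by positivity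
    have hvc : Continuous v := by fun_prop
    set v' : ℝ → ℝ := fun r => f r * deriv f r / v r with hv'
    have hv0 : ∀ r, 0 < v r := fun r => Real.sqrt_pos.2 (hpos r)
    have hv'c : Continuous v' := by
      apply Continuous.div (by fun_prop) hvc fun r => (hv0 r).ne'
    have hvd : ∀ r, HasDerivAt v (v' r) r := by
      intro r
      have h1 : HasDerivAt f (deriv f r) r :=
        (hf.differentiable (by norm_num) r).hasDerivAt
      have h2 : HasDerivAt v _ r := ((h1.fun_pow 2).add_const (ε ^ 2)).sqrt (hpos r).ne'
      refine h2.congr_deriv ?_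
      change _ = f r * deriv f r / √(f r ^ 2 + ε ^ 2)
      have := (hv0 r).ne'
      simp only [hv] at this
      push_cast
      field_simp
    have hfv : ∀ r, |f r| ≤ v r := fun r => Real.abs_le_sqrt (by nlinarith [sq_nonneg ε])
    have hvf : ∀ r, v r ≤ |f r| + ε := fun r => by
      apply Real.sqrt_le_iff.2 ⟨by positivity, ?_⟩
      nlinarith [sq_abs (f r), abs_nonneg (f r)]
    have hv'f : ∀ r, |v' r| ≤ |deriv f r| := fun r => by
      simp only [hv']
      rw [abs_div, abs_mul, abs_of_pos (hv0 r), div_le_iff₀ (hv0 r), mul_comm]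
      gcongr
      exact hfv r
    set w : ℝ → ℝ := fun r => 2 * √r - 2 / √R * r with hw
    have hwc : Continuous w := by fun_prop
    set F' : ℝ → ℝ := fun r => ((√r)⁻¹ - 2 / √R) * v r + w r * v' r with hF'
    have hF'int : IntervalIntegrable F' volume 0 R := by
      have h1 := ((intervalIntegrable_inv_sqrt R).sub
        (intervalIntegrable_const (c := 2 / √R))).mul_continuousOn hvc.continuousOn
      exact h1.add ((hwc.mul hv'c).intervalIntegrable 0 R)
    have hFTC : ∫ r in (0 : ℝ)..R, F' r = 0 := by
      rw [intervalIntegral.integral_eq_sub_of_hasDerivAt_of_le (f := fun r => w r * v r) hR.le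
        (by fun_prop) _ hF'int]
      · have : w R = 0 := by
          simp only [hw]
          field_simp
          rw [Real.sq_sqrt hR.le]; ring
        have h0 : w 0 = 0 := by simp [hw]
        simp [this, h0]
      · intro r hr
        have h1 : HasDerivAt w ((√r)⁻¹ - 2 / √R) r := by
          have := ((Real.hasDerivAt_sqrt hr.1.ne').const_mul 2).sub
            ((hasDerivAt_id r).const_mul (2 / √R))
          refine this.congr_deriv ?_
          have := (Real.sqrt_pos.2 hr.1).ne'
          field_simp
        exact h1.mul (hvd r)
    have hint1 : IntervalIntegrable (fun r => (√r)⁻¹ * |f r|) volume 0 R :=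
      (intervalIntegrable_inv_sqrt R).mul_continuousOn hf0.abs.continuousOn
    have hint2 : IntervalIntegrable (fun r => 2 / √R * |f r|) volume 0 R :=
      Continuous.intervalIntegrable (by fun_prop) 0 R
    have hint3 : IntervalIntegrable (fun r => 2 * (√r * |deriv f r|)) volume 0 R :=
      Continuous.intervalIntegrable (by fun_prop) 0 R
    have hmono : ∫ r in (0 : ℝ)..R, (√r)⁻¹ * |f r| ≤ ∫ r in (0 : ℝ)..R,
        (F' r + (2 / √R * |f r| + 2 * (√r * |deriv f r|) + 2 / √R * ε)) := by
      refine intervalIntegral.integral_mono_on_of_le_Ioo hR.le hint1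
        (hF'int.add ((hint2.add hint3).add intervalIntegrable_const)) fun r hr => ?_
      have hsr : 0 < √r := Real.sqrt_pos.2 hr.1
      have hw0 : 0 ≤ w r := by
        have h1 : √r ≤ √R := Real.sqrt_le_sqrt hr.2.le
        have h2 : 2 / √R * r ≤ 2 * √r := by
          rw [div_mul_eq_mul_div, div_le_iff₀ hsR]
          nlinarith [Real.mul_self_sqrt hr.1.le]
        simp only [hw]; linarith
      have hw1 : w r ≤ 2 * √r := by
        have : 0 ≤ 2 / √R * r := by have := hr.1; positivity
        simp only [hw]; linarith
      have h1 : (√r)⁻¹ * |f r| ≤ (√r)⁻¹ * v r := by gcongr; exact hfv r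
      have h2 : 2 / √R * v r ≤ 2 / √R * (|f r| + ε) := by gcongr; exact hvf r
      have h3 : -(w r * v' r) ≤ 2 * (√r * |deriv f r|) := by
        calc -(w r * v' r) ≤ |w r * v' r| := neg_le_abs _
          _ = w r * |v' r| := by rw [abs_mul, abs_of_nonneg hw0]
          _ ≤ (2 * √r) * |deriv f r| :=
            mul_le_mul hw1 (hv'f r) (abs_nonneg _) (by positivity)
          _ = _ := by ring
      simp only [hF']
      nlinarith
    rw [intervalIntegral.integral_add hF'int ((hint2.add hint3).add intervalIntegrable_const),
      intervalIntegral.integral_add (hint2.add hint3) intervalIntegrable_const,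
      intervalIntegral.integral_add hint2 hint3, hFTC, intervalIntegral.integral_const_mul,
      intervalIntegral.integral_const_mul, intervalIntegral.integral_const] at hmono
    simp only [smul_eq_mul, sub_zero, zero_add] at hmono
    linarith
  refine le_of_forall_pos_le_add fun ε hε => ?_
  have hc : 0 < 2 / √R * R := by positivity
  have := key (ε / (2 / √R * R)) (by positivity)
  rwa [mul_div_cancel₀ _ hc.ne'] at this

theorem ofReal_intervalIntegral {f : ℝ → ℝ} {R : ℝ} (hR : 0 ≤ R) (h0 : ∀ r, 0 ≤ f r)
    (hf : IntervalIntegrable f volume 0 R) :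
    ENNReal.ofReal (∫ r in (0 : ℝ)..R, f r) = ∫⁻ r in Ioo 0 R, ENNReal.ofReal (f r) := by
  rw [intervalIntegral.integral_of_le hR,
    ofReal_integral_eq_lintegral_ofReal hf.1 (Eventually.of_forall h0),
    restrict_Ioo_eq_restrict_Ioc]

theorem lintegral_inv_sqrt_mul_enorm_le {f : ℝ → ℝ} (hf : ContDiff ℝ 1 f) {R : ℝ} (hR : 0 < R) :
    ∫⁻ r in Ioo 0 R, ENNReal.ofReal (√r)⁻¹ * ‖f r‖ₑ ≤
      ENNReal.ofReal (2 / √R) * (∫⁻ r in Ioo 0 R, ‖f r‖ₑ) +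
        2 * ∫⁻ r in Ioo 0 R, ENNReal.ofReal (√r) * ‖deriv f r‖ₑ := by
  have hf0 : Continuous f := hf.continuous
  have hf1 : Continuous (deriv f) := hf.continuous_deriv le_rfl
  have h := ENNReal.ofReal_le_ofReal (integral_inv_sqrt_mul_abs_le hf hR)
  rw [ENNReal.ofReal_add (mul_nonneg (by positivity)
      (intervalIntegral.integral_nonneg hR.le fun r _ => by positivity))
      (mul_nonneg (by positivity)
      (intervalIntegral.integral_nonneg hR.le fun r _ => by positivity)),
    ENNReal.ofReal_mul (by positivity), ENNReal.ofReal_mul (by positivity),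
    ofReal_intervalIntegral hR.le (fun r => by positivity)
      ((intervalIntegrable_inv_sqrt R).mul_continuousOn hf0.abs.continuousOn),
    ofReal_intervalIntegral hR.le (fun r => by positivity)
      (hf0.abs.intervalIntegrable 0 R),
    ofReal_intervalIntegral hR.le (fun r => by positivity)
      (Continuous.intervalIntegrable (by fun_prop) 0 R)] at h
  have e1 : ∀ r, ENNReal.ofReal ((√r)⁻¹ * |f r|) = ENNReal.ofReal (√r)⁻¹ * ‖f r‖ₑ := fun r => by
    rw [ENNReal.ofReal_mul (by positivity), ← Real.enorm_eq_ofReal_abs]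
  have e2 : ∀ r, ENNReal.ofReal (√r * |deriv f r|) = ENNReal.ofReal (√r) * ‖deriv f r‖ₑ :=
    fun r => by rw [ENNReal.ofReal_mul (by positivity), ← Real.enorm_eq_ofReal_abs]
  simpa only [e1, e2, ← Real.enorm_eq_ofReal_abs, ENNReal.ofReal_ofNat] using h

/-! ### The weighted estimate for smooth functions -/

/-- The `ℓ¹` size `|∂₁u| + |∂₂u|` of the gradient of `u`, as an extended nonnegative real. -/
noncomputable def gradSize (u : ℝ × ℝ → ℝ) (p : ℝ × ℝ) : ℝ≥0∞ :=
  ‖fderiv ℝ u p (1, 0)‖ₑ + ‖fderiv ℝ u p (0, 1)‖ₑ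

theorem continuous_gradSize {u : ℝ × ℝ → ℝ} (hu : ContDiff ℝ 1 u) : Continuous (gradSize u) := by
  have h := hu.continuous_fderiv one_ne_zero
  unfold gradSize
  fun_prop

theorem enorm_fderiv_le_gradSize (u : ℝ × ℝ → ℝ) (p : ℝ × ℝ) {a b m : ℝ} (ha : |a| ≤ m)
    (hb : |b| ≤ m) : ‖fderiv ℝ u p (a, b)‖ₑ ≤ ENNReal.ofReal m * gradSize u p := by
  have h : fderiv ℝ u p (a, b) = a * fderiv ℝ u p (1, 0) + b * fderiv ℝ u p (0, 1) := by
    rw [← smul_eq_mul, ← smul_eq_mul, ← map_smul, ← map_smul, ← map_add]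
    simp
  rw [h, gradSize, mul_add]
  refine (enorm_add_le _ _).trans ?_
  rw [enorm_mul, enorm_mul, Real.enorm_eq_ofReal_abs a, Real.enorm_eq_ofReal_abs b]
  gcongr

theorem measurableSet_halfDisc (R : ℝ) : MeasurableSet (halfDisc R) := by
  have h1 : MeasurableSet {p : ℝ × ℝ | p.1 ^ 2 + p.2 ^ 2 < R ^ 2} :=
    measurableSet_lt (by fun_prop) (by fun_prop)
  have h2 : MeasurableSet {p : ℝ × ℝ | 0 < p.2} := measurableSet_lt (by fun_prop) (by fun_prop)
  exact h1.inter h2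

theorem rpow_half_lintegral_gradSize_sq_le {u : ℝ × ℝ → ℝ} (hu : ContDiff ℝ 1 u) (μ : Measure (ℝ × ℝ)) :
    (∫⁻ p, gradSize u p ^ 2 ∂μ) ^ (1 / 2 : ℝ) ≤
      eLpNorm (fun p => fderiv ℝ u p (1, 0)) 2 μ + eLpNorm (fun p => fderiv ℝ u p (0, 1)) 2 μ := by
  have h := hu.continuous_fderiv one_ne_zero
  have h1 : Continuous fun p => fderiv ℝ u p (1, 0) := by fun_prop
  have h2 : Continuous fun p => fderiv ℝ u p (0, 1) := by fun_prop
  rw [eLpNorm_two_eq_rpow_half, eLpNorm_two_eq_rpow_half]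
  simpa [gradSize] using ENNReal.lintegral_Lp_add_le (μ := μ) (p := 2)
    h1.enorm.measurable.aemeasurable h2.enorm.measurable.aemeasurable (by norm_num)

/-- The image under polar coordinates of the rectangle `(0,R) × (0,1)` lies in the half disc. -/
theorem polar_mem_halfDisc {R r θ : ℝ} (hr : r ∈ Ioo 0 R) (hθ : θ ∈ Ioo (0 : ℝ) 1) :
    (r * Real.cos θ, r * Real.sin θ) ∈ halfDisc R := by
  refine ⟨?_, mul_pos hr.1 (Real.sin_pos_of_pos_of_le_one hθ.1 hθ.2.le)⟩
  have : (r * Real.cos θ) ^ 2 + (r * Real.sin θ) ^ 2 = r ^ 2 := by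
    linear_combination r ^ 2 * Real.cos_sq_add_sin_sq θ
  simp only [this]
  exact pow_lt_pow_left₀ hr.2 hr.1.le two_ne_zero

/-- Integration in polar coordinates over the sector of angles `(0,1)`. An angular interval of length
`1` makes the average over the angle an integral. -/
theorem lintegral_polar_le {F : ℝ × ℝ → ℝ≥0∞} (hF : Measurable F) (R : ℝ) :
    ∫⁻ r in Ioo 0 R, ∫⁻ θ in Ioo (0 : ℝ) 1,
      ENNReal.ofReal r * F (r * Real.cos θ, r * Real.sin θ) ≤ ∫⁻ p in halfDisc R, F p := by
  rw [← lintegral_indicator (measurableSet_halfDisc R), ← lintegral_comp_polarCoord_symm]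
  have hm : Measurable fun q : ℝ × ℝ =>
      ENNReal.ofReal q.1 * F (q.1 * Real.cos q.2, q.1 * Real.sin q.2) := by fun_prop
  rw [← lintegral_prod (fun q : ℝ × ℝ =>
      ENNReal.ofReal q.1 * F (q.1 * Real.cos q.2, q.1 * Real.sin q.2)) hm.aemeasurable,
    Measure.prod_restrict]
  have hsub : Ioo 0 R ×ˢ Ioo (0 : ℝ) 1 ⊆ polarCoord.target := by
    rintro ⟨r, θ⟩ ⟨hr, hθ⟩
    have := Real.pi_gt_three
    refine ⟨hr.1, ?_, ?_⟩
    · have := hθ.1; dsimp at this ⊢; linarith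
    · have := hθ.2; dsimp at this ⊢; linarith
  refine le_trans ?_ (lintegral_mono_set hsub)
  refine setLIntegral_mono' (measurableSet_Ioo.prod measurableSet_Ioo) fun q hq => ?_
  rw [polarCoord_symm_apply, indicator_of_mem (polar_mem_halfDisc hq.1 hq.2), smul_eq_mul]

/-- The integral that controls both the angular and the radial increments. The area element is
`r dr dθ`, so the norm of `√r |∇u|` in `L²(dr dθ)` is at most that of `|∇u|` on the half disc;
the factor `√R` is the norm of `1` over the rectangle `(0,R) × (0,1)`. -/
theorem lintegral_sqrt_mul_gradSize_le {u : ℝ × ℝ → ℝ} (hu : ContDiff ℝ 1 u) (R : ℝ) :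
    ∫⁻ r in Ioo 0 R, ∫⁻ θ in Ioo (0 : ℝ) 1,
      ENNReal.ofReal (√r) * gradSize u (r * Real.cos θ, r * Real.sin θ) ≤
      ENNReal.ofReal R ^ (1 / 2 : ℝ) *
        (eLpNorm (fun p => fderiv ℝ u p (1, 0)) 2 (volume.restrict (halfDisc R)) +
          eLpNorm (fun p => fderiv ℝ u p (0, 1)) 2 (volume.restrict (halfDisc R))) := by
  have hG := (continuous_gradSize hu).measurable
  have hm : Measurable fun q : ℝ × ℝ =>
      ENNReal.ofReal (√q.1) * gradSize u (q.1 * Real.cos q.2, q.1 * Real.sin q.2) := by fun_prop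
  rw [← lintegral_prod _ hm.aemeasurable, Measure.prod_restrict]
  have h := lintegral_mul_le_rpow_half ((volume : Measure (ℝ × ℝ)).restrict
    (Ioo 0 R ×ˢ Ioo (0 : ℝ) 1)) hm.aemeasurable (measurable_const (a := (1 : ℝ≥0∞))).aemeasurable
  simp only [mul_one, one_pow, lintegral_const, one_mul, Measure.restrict_apply_univ] at h
  rw [Measure.volume_eq_prod, Measure.prod_prod, Real.volume_Ioo, Real.volume_Ioo] at h
  simp only [sub_zero, ENNReal.ofReal_one, mul_one] at h
  refine h.trans ?_
  rw [mul_comm]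
  gcongr
  refine le_trans ?_ (rpow_half_lintegral_gradSize_sq_le hu _)
  refine ENNReal.rpow_le_rpow ?_ (by norm_num)
  refine le_trans ?_ (lintegral_polar_le (hG.pow_const 2) R)
  have hm2 : Measurable fun q : ℝ × ℝ =>
      ENNReal.ofReal q.1 * gradSize u (q.1 * Real.cos q.2, q.1 * Real.sin q.2) ^ 2 := by fun_prop
  rw [← lintegral_prod (fun q : ℝ × ℝ =>
    ENNReal.ofReal q.1 * gradSize u (q.1 * Real.cos q.2, q.1 * Real.sin q.2) ^ 2) hm2.aemeasurable,
    Measure.prod_restrict]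
  refine setLIntegral_mono' (measurableSet_Ioo.prod measurableSet_Ioo) fun q hq => ?_
  rw [mul_pow, ← ENNReal.ofReal_pow (Real.sqrt_nonneg _), Real.sq_sqrt hq.1.1.le]

/-- Moving along the arc of radius `r` from the positive axis costs at most `r` times the integral of
the gradient over the arc. -/
theorem enorm_polar_sub_le {u : ℝ × ℝ → ℝ} (hu : ContDiff ℝ 1 u) {r θ : ℝ} (hr : 0 ≤ r)
    (hθ : θ ∈ Ioo (0 : ℝ) 1) :
    ‖u (r * Real.cos θ, r * Real.sin θ) - u (r, 0)‖ₑ ≤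
      ENNReal.ofReal r * ∫⁻ σ in Ioo (0 : ℝ) 1,
        gradSize u (r * Real.cos σ, r * Real.sin σ) := by
  have hd : ContDiff ℝ 1 fun σ : ℝ => u (r * Real.cos σ, r * Real.sin σ) :=
    hu.comp (by fun_prop)
  have h := enorm_sub_le_lintegral_deriv_of_contDiffOn_Icc hd.contDiffOn hθ.1.le
  simp only [Real.cos_zero, Real.sin_zero, mul_one, mul_zero] at h
  refine h.trans ?_
  rw [← lintegral_const_mul' _ _ ENNReal.ofReal_ne_top, ← restrict_Ioo_eq_restrict_Icc]
  refine (lintegral_mono_set (Ioo_subset_Ioo_right hθ.2.le)).trans (lintegral_mono fun σ => ?_)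
  have h1 : HasDerivAt (fun σ : ℝ => (r * Real.cos σ, r * Real.sin σ))
      (r * -Real.sin σ, r * Real.cos σ) σ :=
    ((Real.hasDerivAt_cos σ).const_mul r).prodMk ((Real.hasDerivAt_sin σ).const_mul r)
  have h2 := ((hu.differentiable one_ne_zero _).hasFDerivAt.comp_hasDerivAt σ h1).deriv
  simp only [Function.comp_def] at h2
  rw [h2]
  apply enorm_fderiv_le_gradSize
  · rw [abs_mul, abs_of_nonneg hr, abs_neg]
    exact mul_le_of_le_one_right hr (Real.abs_sin_le_one σ)
  · rw [abs_mul, abs_of_nonneg hr]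
    exact mul_le_of_le_one_right hr (Real.abs_cos_le_one σ)

/-- The one-dimensional weighted inequality on the ray at angle `θ`. -/
theorem lintegral_ray_le {u : ℝ × ℝ → ℝ} (hu : ContDiff ℝ 1 u) {R : ℝ} (hR : 0 < R) (θ : ℝ) :
    ∫⁻ r in Ioo 0 R, ENNReal.ofReal (√r)⁻¹ * ‖u (r * Real.cos θ, r * Real.sin θ)‖ₑ ≤
      ENNReal.ofReal (2 / √R) * (∫⁻ r in Ioo 0 R, ‖u (r * Real.cos θ, r * Real.sin θ)‖ₑ) +
        2 * ∫⁻ r in Ioo 0 R, ENNReal.ofReal (√r) *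
          gradSize u (r * Real.cos θ, r * Real.sin θ) := by
  have hd : ContDiff ℝ 1 fun r : ℝ => u (r * Real.cos θ, r * Real.sin θ) :=
    hu.comp (by fun_prop)
  refine (lintegral_inv_sqrt_mul_enorm_le hd hR).trans ?_
  gcongr with r
  have h1 : HasDerivAt (fun r : ℝ => (r * Real.cos θ, r * Real.sin θ))
      (1 * Real.cos θ, 1 * Real.sin θ) r :=
    ((hasDerivAt_id r).mul_const _).prodMk ((hasDerivAt_id r).mul_const _)
  have h2 := ((hu.differentiable one_ne_zero _).hasFDerivAt.comp_hasDerivAt r h1).deriv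
  simp only [Function.comp_def] at h2
  rw [h2, ← one_mul (gradSize _ _), ← ENNReal.ofReal_one]
  apply enorm_fderiv_le_gradSize <;> rw [one_mul]
  · exact Real.abs_cos_le_one θ
  · exact Real.abs_sin_le_one θ

/-- The weighted estimate for continuously differentiable functions. -/
theorem lintegral_inv_sqrt_mul_trace_le {u : ℝ × ℝ → ℝ} (hu : ContDiff ℝ 1 u) {R : ℝ}
    (hR : 0 < R) :
    ∫⁻ r in Ioo 0 R, ENNReal.ofReal (√r)⁻¹ * ‖u (r, 0)‖ₑ ≤
      2 * eLpNorm (fun r => u (r, 0)) 2 (volume.restrict (Ioo 0 R)) +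
      5 * (ENNReal.ofReal R ^ (1 / 2 : ℝ) *
        (eLpNorm (fun p => fderiv ℝ u p (1, 0)) 2 (volume.restrict (halfDisc R)) +
          eLpNorm (fun p => fderiv ℝ u p (0, 1)) 2 (volume.restrict (halfDisc R)))) := by
  have hG := (continuous_gradSize hu).measurable
  have hum : Measurable u := hu.continuous.measurable
  have hsR : 0 < √R := Real.sqrt_pos.2 hR
  set J := ∫⁻ r in Ioo 0 R, ∫⁻ θ in Ioo (0 : ℝ) 1,
      ENNReal.ofReal (√r) * gradSize u (r * Real.cos θ, r * Real.sin θ) with hJ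
  set A := ∫⁻ r in Ioo 0 R, ‖u (r, 0)‖ₑ with hA
  set I : ℝ → ℝ≥0∞ := fun r => ∫⁻ σ in Ioo (0 : ℝ) 1,
        gradSize u (r * Real.cos σ, r * Real.sin σ) with hI
  have hIm : Measurable I := by
    apply Measurable.lintegral_prod_right' (ν := volume.restrict (Ioo (0 : ℝ) 1))
      (f := fun q : ℝ × ℝ => gradSize u (q.1 * Real.cos q.2, q.1 * Real.sin q.2))
    fun_prop
  have hJI : J = ∫⁻ r in Ioo 0 R, ENNReal.ofReal (√r) * I r := by
    simp only [hJ, hI]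
    congr with r
    rw [lintegral_const_mul' _ _ ENNReal.ofReal_ne_top]
  have hray : ∀ θ ∈ Ioo (0 : ℝ) 1,
      ∫⁻ r in Ioo 0 R, ENNReal.ofReal (√r)⁻¹ * ‖u (r, 0)‖ₑ ≤
        ENNReal.ofReal (2 / √R) * A + 3 * J +
          2 * ∫⁻ r in Ioo 0 R, ENNReal.ofReal (√r) *
            gradSize u (r * Real.cos θ, r * Real.sin θ) := by
    intro θ hθ
    -- from the axis to the ray; the angular term is `(√r)⁻¹ * r = √r`
    have s1 : ∫⁻ r in Ioo 0 R, ENNReal.ofReal (√r)⁻¹ * ‖u (r, 0)‖ₑ ≤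
        (∫⁻ r in Ioo 0 R, ENNReal.ofReal (√r)⁻¹ * ‖u (r * Real.cos θ, r * Real.sin θ)‖ₑ) + J := by
      rw [hJI, ← lintegral_add_left (by fun_prop)]
      refine setLIntegral_mono' measurableSet_Ioo fun r hr => ?_
      have h1 : ‖u (r, 0)‖ₑ ≤ ‖u (r * Real.cos θ, r * Real.sin θ)‖ₑ + ENNReal.ofReal r * I r := by
        have h2 := enorm_polar_sub_le hu hr.1.le hθ
        calc ‖u (r, 0)‖ₑ = ‖u (r * Real.cos θ, r * Real.sin θ) -
              (u (r * Real.cos θ, r * Real.sin θ) - u (r, 0))‖ₑ := by congr 1; ring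
          _ ≤ _ := enorm_sub_le
          _ ≤ _ := by gcongr
      refine (mul_le_mul_right h1 _).trans_eq ?_
      rw [mul_add, ← mul_assoc (ENNReal.ofReal _), ← ENNReal.ofReal_mul (by positivity)]
      congr 3
      have := (Real.sqrt_pos.2 hr.1).ne'
      field_simp
      rw [Real.sq_sqrt hr.1.le]
    -- from the ray back to the axis; here the angular term is `2 / √R * r ≤ 2 * √r`
    have s2 : ENNReal.ofReal (2 / √R) *
        (∫⁻ r in Ioo 0 R, ‖u (r * Real.cos θ, r * Real.sin θ)‖ₑ) ≤
        ENNReal.ofReal (2 / √R) * A + 2 * J := by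
      rw [hJI, hA, ← lintegral_const_mul' _ _ ENNReal.ofReal_ne_top,
        ← lintegral_const_mul' _ _ ENNReal.ofReal_ne_top,
        ← lintegral_const_mul' _ _ (by norm_num), ← lintegral_add_left (by fun_prop)]
      refine setLIntegral_mono' measurableSet_Ioo fun r hr => ?_
      have h1 : ‖u (r * Real.cos θ, r * Real.sin θ)‖ₑ ≤ ‖u (r, 0)‖ₑ + ENNReal.ofReal r * I r := by
        have h2 := enorm_polar_sub_le hu hr.1.le hθ
        calc ‖u (r * Real.cos θ, r * Real.sin θ)‖ₑ = ‖u (r, 0) +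
              (u (r * Real.cos θ, r * Real.sin θ) - u (r, 0))‖ₑ := by congr 1; ring
          _ ≤ _ := enorm_add_le _ _
          _ ≤ _ := by gcongr
      refine (mul_le_mul_right h1 _).trans ?_
      rw [mul_add, ← mul_assoc (ENNReal.ofReal _), ← ENNReal.ofReal_mul (by positivity),
        ← mul_assoc 2, ← ENNReal.ofReal_ofNat 2, ← ENNReal.ofReal_mul (by positivity)]
      refine add_le_add le_rfl (mul_le_mul_left (ENNReal.ofReal_le_ofReal ?_) _)
      have hle : √r ≤ √R := Real.sqrt_le_sqrt hr.2.le
      rw [div_mul_eq_mul_div, div_le_iff₀ hsR]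
      nlinarith [Real.mul_self_sqrt hr.1.le, Real.sqrt_nonneg r]
    have s3 := lintegral_ray_le hu hR θ
    calc _ ≤ _ := s1
      _ ≤ _ := add_le_add_left s3 J
      _ ≤ (ENNReal.ofReal (2 / √R) * A + 2 * J +
          2 * ∫⁻ r in Ioo 0 R, ENNReal.ofReal (√r) *
            gradSize u (r * Real.cos θ, r * Real.sin θ)) + J := by gcongr
      _ = _ := by ring
  have hK : ∫⁻ r in Ioo 0 R, ENNReal.ofReal (√r)⁻¹ * ‖u (r, 0)‖ₑ ≤
      ENNReal.ofReal (2 / √R) * A + 5 * J := by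
    have h := setLIntegral_mono' (μ := volume) measurableSet_Ioo hray
    rw [lintegral_const, lintegral_add_left measurable_const, lintegral_const,
      lintegral_const_mul' _ _ (by norm_num)] at h
    simp only [Measure.restrict_apply_univ, Real.volume_Ioo, sub_zero, ENNReal.ofReal_one,
      mul_one] at h
    rw [lintegral_lintegral_swap] at h
    · refine h.trans_eq ?_
      rw [← hJ]; ring
    · exact Measurable.aemeasurable (by fun_prop)
  have hA2 : ENNReal.ofReal (2 / √R) * A ≤
      2 * eLpNorm (fun r => u (r, 0)) 2 (volume.restrict (Ioo 0 R)) := by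
    have h := lintegral_mul_le_rpow_half (volume.restrict (Ioo 0 R))
      (f := fun r => ‖u (r, 0)‖ₑ) (g := fun _ => 1) (by fun_prop) (by fun_prop)
    simp only [mul_one, one_pow, lintegral_const, one_mul, Measure.restrict_apply_univ,
      Real.volume_Ioo, sub_zero] at h
    rw [← eLpNorm_two_eq_rpow_half, ENNReal.ofReal_rpow_of_pos hR, ← Real.sqrt_eq_rpow] at h
    calc _ ≤ ENNReal.ofReal (2 / √R) * _ := mul_le_mul_right h _
      _ = (ENNReal.ofReal (2 / √R) * ENNReal.ofReal (√R)) *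
        eLpNorm (fun r => u (r, 0)) 2 (volume.restrict (Ioo 0 R)) := by ring
      _ = _ := by
        rw [← ENNReal.ofReal_mul (by positivity), div_mul_cancel₀ _ hsR.ne', ENNReal.ofReal_ofNat]
  refine hK.trans ?_
  gcongr
  exact lintegral_sqrt_mul_gradSize_le hu R

/-! ### The trace bound in `L²` for smooth functions -/

/-- Translating the segment `(0,R) × {0}` in the direction `(-1,1)` keeps it in the half disc up to
height `R / 2`. -/
theorem shear_mem_halfDisc {R x s : ℝ} (hx : x ∈ Ioo 0 R) (hs : s ∈ Ioo 0 (R / 2)) :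
    (x - s, s) ∈ halfDisc R := by
  obtain ⟨hx0, hx1⟩ := hx
  obtain ⟨hs0, hs1⟩ := hs
  refine ⟨?_, hs0⟩
  simp only
  nlinarith [mul_pos hx0 hs0, mul_pos (sub_pos.2 hx1) hx0, mul_pos (sub_pos.2 hs1) hs0,
    mul_pos (sub_pos.2 hx1) hs0]

theorem lintegral_shear_le {F : ℝ × ℝ → ℝ≥0∞} (hF : Measurable F) (R : ℝ) :
    ∫⁻ x in Ioo 0 R, ∫⁻ s in Ioo 0 (R / 2), F (x - s, s) ≤ ∫⁻ p in halfDisc R, F p := by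
  rw [lintegral_lintegral_swap (Measurable.aemeasurable (by fun_prop)),
    ← lintegral_indicator (measurableSet_halfDisc R), Measure.volume_eq_prod,
    lintegral_prod_symm' _ (hF.indicator (measurableSet_halfDisc R)),
    ← lintegral_indicator measurableSet_Ioo]
  refine lintegral_mono fun s => ?_
  by_cases hs : s ∈ Ioo 0 (R / 2)
  · rw [indicator_of_mem hs,
      ← lintegral_sub_right_eq_self (fun x => (halfDisc R).indicator F (x, s)) s,
      ← lintegral_indicator measurableSet_Ioo]
    refine lintegral_mono fun x => ?_
    by_cases hx : x ∈ Ioo 0 R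
    · rw [indicator_of_mem hx, indicator_of_mem (shear_mem_halfDisc hx hs)]
    · rw [indicator_of_notMem hx]; exact zero_le
  · rw [indicator_of_notMem hs]; exact zero_le

theorem enorm_shear_sub_le {u : ℝ × ℝ → ℝ} (hu : ContDiff ℝ 1 u) (x : ℝ) {s b : ℝ}
    (hs : s ∈ Ioo 0 b) :
    ‖u (x - s, s) - u (x, 0)‖ₑ ≤ ∫⁻ σ in Ioo 0 b, gradSize u (x - σ, σ) := by
  have hd : ContDiff ℝ 1 fun σ : ℝ => u (x - σ, σ) := hu.comp (by fun_prop)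
  have h := enorm_sub_le_lintegral_deriv_of_contDiffOn_Icc hd.contDiffOn hs.1.le
  simp only [sub_zero] at h
  refine h.trans ?_
  rw [← restrict_Ioo_eq_restrict_Icc]
  refine (lintegral_mono_set (Ioo_subset_Ioo_right hs.2.le)).trans (lintegral_mono fun σ => ?_)
  have h1 : HasDerivAt (fun σ : ℝ => (x - σ, σ)) (-1, 1) σ :=
    ((hasDerivAt_id σ).const_sub x).prodMk (hasDerivAt_id σ)
  have h2 := ((hu.differentiable one_ne_zero _).hasFDerivAt.comp_hasDerivAt σ h1).deriv
  simp only [Function.comp_def] at h2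
  rw [h2, ← one_mul (gradSize _ _), ← ENNReal.ofReal_one]
  apply enorm_fderiv_le_gradSize <;> simp

theorem ennreal_add_sq_le (a b : ℝ≥0∞) : (a + b) ^ 2 ≤ 2 * a ^ 2 + 2 * b ^ 2 := by
  have h := ENNReal.rpow_add_le_mul_rpow_add_rpow a b (p := 2) (by norm_num)
  norm_num at h
  rwa [mul_add] at h

/-- The fundamental theorem of calculus on the segments from `(x,0)` to `(x - s,s)`, squared, and
averaged over `s ∈ (0, R/2)`. -/
theorem lintegral_sq_trace_le {u : ℝ × ℝ → ℝ} (hu : ContDiff ℝ 1 u) {R : ℝ} (hR : 0 < R) :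
    ∫⁻ x in Ioo 0 R, ‖u (x, 0)‖ₑ ^ 2 ≤
      ENNReal.ofReal (4 / R) * (∫⁻ p in halfDisc R, ‖u p‖ₑ ^ 2) +
        ENNReal.ofReal R * ∫⁻ p in halfDisc R, gradSize u p ^ 2 := by
  have hG := (continuous_gradSize hu).measurable
  have hum : Measurable u := hu.continuous.measurable
  set ρ := ENNReal.ofReal (R / 2) with hρ
  have hpt : ∀ x : ℝ, ρ * ‖u (x, 0)‖ₑ ^ 2 ≤
      2 * (∫⁻ s in Ioo 0 (R / 2), ‖u (x - s, s)‖ₑ ^ 2) +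
        2 * ρ * ρ * ∫⁻ σ in Ioo 0 (R / 2), gradSize u (x - σ, σ) ^ 2 := by
    intro x
    set V := ∫⁻ σ in Ioo 0 (R / 2), gradSize u (x - σ, σ) ^ 2 with hV
    have hCS : (∫⁻ σ in Ioo 0 (R / 2), gradSize u (x - σ, σ)) ^ 2 ≤ ρ * V := by
      have h := lintegral_mul_le_rpow_half (volume.restrict (Ioo 0 (R / 2)))
        (f := fun σ => gradSize u (x - σ, σ)) (g := fun _ => 1) (by fun_prop) (by fun_prop)
      simp only [mul_one, one_pow, lintegral_const, one_mul, Measure.restrict_apply_univ,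
        Real.volume_Ioo, sub_zero] at h
      refine (pow_le_pow_left' h 2).trans_eq ?_
      rw [mul_pow, sq_rpow_half, sq_rpow_half, mul_comm]
    have h : ∀ s ∈ Ioo 0 (R / 2), ‖u (x, 0)‖ₑ ^ 2 ≤
        2 * ‖u (x - s, s)‖ₑ ^ 2 + 2 * (ρ * V) := by
      intro s hs
      have h1 : ‖u (x, 0)‖ₑ ≤ ‖u (x - s, s)‖ₑ +
          ∫⁻ σ in Ioo 0 (R / 2), gradSize u (x - σ, σ) := by
        calc ‖u (x, 0)‖ₑ = ‖u (x - s, s) - (u (x - s, s) - u (x, 0))‖ₑ := by congr 1; ring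
          _ ≤ _ := enorm_sub_le
          _ ≤ _ := by gcongr; exact enorm_shear_sub_le hu x hs
      refine (pow_le_pow_left' h1 2).trans ((ennreal_add_sq_le _ _).trans ?_)
      gcongr
    have h2 := setLIntegral_mono' (μ := volume) measurableSet_Ioo h
    rw [lintegral_const, lintegral_add_right _ measurable_const, lintegral_const,
      lintegral_const_mul' _ _ (by norm_num)] at h2
    simp only [Measure.restrict_apply_univ, Real.volume_Ioo, sub_zero, ← hρ] at h2
    refine (mul_comm _ _).trans_le (h2.trans_eq ?_)
    ring
  have hint : ρ * ∫⁻ x in Ioo 0 R, ‖u (x, 0)‖ₑ ^ 2 ≤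
      2 * (∫⁻ p in halfDisc R, ‖u p‖ₑ ^ 2) +
        2 * ρ * ρ * ∫⁻ p in halfDisc R, gradSize u p ^ 2 := by
    have hρt : ρ ≠ ⊤ := ENNReal.ofReal_ne_top
    calc ρ * ∫⁻ x in Ioo 0 R, ‖u (x, 0)‖ₑ ^ 2 = ∫⁻ x in Ioo 0 R, ρ * ‖u (x, 0)‖ₑ ^ 2 :=
          (lintegral_const_mul' _ _ hρt).symm
      _ ≤ ∫⁻ x in Ioo 0 R, (2 * (∫⁻ s in Ioo 0 (R / 2), ‖u (x - s, s)‖ₑ ^ 2) +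
        2 * ρ * ρ * ∫⁻ σ in Ioo 0 (R / 2), gradSize u (x - σ, σ) ^ 2) := lintegral_mono hpt
      _ = 2 * (∫⁻ x in Ioo 0 R, ∫⁻ s in Ioo 0 (R / 2), ‖u (x - s, s)‖ₑ ^ 2) +
        2 * ρ * ρ * ∫⁻ x in Ioo 0 R, ∫⁻ σ in Ioo 0 (R / 2), gradSize u (x - σ, σ) ^ 2 := by
          have hm : Measurable fun x => ∫⁻ s in Ioo 0 (R / 2), ‖u (x - s, s)‖ₑ ^ 2 := by
            apply Measurable.lintegral_prod_right' (ν := volume.restrict (Ioo 0 (R / 2)))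
              (f := fun q : ℝ × ℝ => ‖u (q.1 - q.2, q.2)‖ₑ ^ 2)
            fun_prop
          rw [lintegral_add_left (hm.const_mul 2), lintegral_const_mul' _ _ (by norm_num),
            lintegral_const_mul' _ _
              (ENNReal.mul_ne_top (ENNReal.mul_ne_top (by norm_num) hρt) hρt)]
      _ ≤ _ := by
          gcongr
          · exact lintegral_shear_le (F := fun p => ‖u p‖ₑ ^ 2) (by fun_prop) R
          · exact lintegral_shear_le (F := fun p => gradSize u p ^ 2) (by fun_prop) R
  have hinv : ENNReal.ofReal (2 / R) * ρ = 1 := by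
    rw [hρ, ← ENNReal.ofReal_mul (by positivity), ← ENNReal.ofReal_one]
    congr 1; field_simp
  have h4 : ENNReal.ofReal (4 / R) = ENNReal.ofReal (2 / R) * 2 := by
    rw [← ENNReal.ofReal_ofNat 2, ← ENNReal.ofReal_mul (by positivity)]
    congr 1; ring
  have h2 : ENNReal.ofReal R = 2 * ρ := by
    rw [← ENNReal.ofReal_ofNat 2, hρ, ← ENNReal.ofReal_mul (by positivity)]
    congr 1; ring
  calc ∫⁻ x in Ioo 0 R, ‖u (x, 0)‖ₑ ^ 2
      = ENNReal.ofReal (2 / R) * (ρ * ∫⁻ x in Ioo 0 R, ‖u (x, 0)‖ₑ ^ 2) := by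
        rw [← mul_assoc, hinv, one_mul]
    _ ≤ _ := mul_le_mul_right hint _
    _ = ENNReal.ofReal (2 / R) * 2 * (∫⁻ p in halfDisc R, ‖u p‖ₑ ^ 2) +
        (ENNReal.ofReal (2 / R) * ρ) * (2 * ρ) * ∫⁻ p in halfDisc R, gradSize u p ^ 2 := by ring
    _ = _ := by rw [hinv, one_mul, h4, h2]

/-! ### Mollification in `L²` -/

/-- Convolution with a normalized bump function is a contraction of `L²`. -/
theorem eLpNorm_bump_convolution_le (ρ : ContDiffBump (0 : ℝ × ℝ)) {F : ℝ × ℝ → ℝ}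
    (hF : AEStronglyMeasurable F volume) :
    eLpNorm (ρ.normed volume ⋆[lsmul ℝ ℝ, volume] F) 2 volume ≤ eLpNorm F 2 volume := by
  set k := ρ.normed (volume : Measure (ℝ × ℝ)) with hk
  have hkc : Continuous k := ρ.continuous_normed
  have hk0 : ∀ t, 0 ≤ k t := ρ.nonneg_normed
  have hk1 : ∫⁻ t, ‖k t‖ₑ = 1 := by
    have h := ofReal_integral_eq_lintegral_ofReal (ρ.integrable_normed (μ := volume))
      (Eventually.of_forall hk0)
    rw [ρ.integral_normed, ENNReal.ofReal_one] at h
    rw [h]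
    exact lintegral_congr fun t => Real.enorm_of_nonneg (hk0 t)
  have hsub : ∀ x : ℝ × ℝ, AEMeasurable (fun t => ‖F (x - t)‖ₑ) volume := fun x =>
    (hF.comp_quasiMeasurePreserving
      (quasiMeasurePreserving_sub_left_of_right_invariant volume x)).enorm
  have hpt : ∀ x, ‖(k ⋆[lsmul ℝ ℝ, volume] F) x‖ₑ ^ 2 ≤ ∫⁻ t, ‖k t‖ₑ * ‖F (x - t)‖ₑ ^ 2 := by
    intro x
    have h1 : ‖(k ⋆[lsmul ℝ ℝ, volume] F) x‖ₑ ≤ ∫⁻ t, ‖k t‖ₑ * ‖F (x - t)‖ₑ := by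
      refine (enorm_integral_le_lintegral_enorm _).trans_eq (lintegral_congr fun t => ?_)
      simp [enorm_mul]
    -- `k` has total mass `1`, so Jensen's inequality is Cauchy–Schwarz with `√k` split off
    have hsq : ∀ t, ‖k t‖ₑ = ‖√(k t)‖ₑ * ‖√(k t)‖ₑ := fun t => by
      rw [← enorm_mul, Real.mul_self_sqrt (hk0 t)]
    have h2 := lintegral_mul_le_rpow_half volume (f := fun t => ‖√(k t)‖ₑ)
      (g := fun t => ‖√(k t)‖ₑ * ‖F (x - t)‖ₑ) (by fun_prop)
      (AEMeasurable.mul (by fun_prop) (hsub x))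
    simp only [mul_pow, ← mul_assoc, sq (‖√(k _)‖ₑ), ← hsq, hk1, ENNReal.one_rpow, one_mul] at h2
    refine (pow_le_pow_left' (h1.trans h2) 2).trans_eq ?_
    rw [sq_rpow_half]
  rw [eLpNorm_two_eq_rpow_half, eLpNorm_two_eq_rpow_half]
  refine ENNReal.rpow_le_rpow ?_ (by norm_num)
  refine (lintegral_mono hpt).trans_eq ?_
  have hm : AEMeasurable (Function.uncurry fun (x t : ℝ × ℝ) => ‖k t‖ₑ * ‖F (x - t)‖ₑ ^ 2)
      (volume.prod volume) := by
    refine AEMeasurable.mul (hkc.enorm.measurable.comp measurable_snd).aemeasurable ?_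
    exact ((hF.comp_quasiMeasurePreserving
      (quasiMeasurePreserving_sub_of_right_invariant volume volume)).enorm).pow_const 2
  rw [lintegral_lintegral_swap hm]
  have : ∀ t : ℝ × ℝ, ∫⁻ x, ‖k t‖ₑ * ‖F (x - t)‖ₑ ^ 2 = ‖k t‖ₑ * ∫⁻ x, ‖F x‖ₑ ^ 2 := fun t => by
    rw [lintegral_const_mul' _ _ enorm_ne_top,
      lintegral_sub_right_eq_self (fun x => ‖F x‖ₑ ^ 2) t]
  simp only [this]
  rw [lintegral_mul_const'' _ (by fun_prop), hk1, one_mul]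

/-- The constant `2` is uniform because the contraction factor `1 - ε` is at least `1 / 2`. -/
theorem eLpNorm_comp_contraction_le {ε : ℝ} (hε : ε ∈ Ioc 0 (1 / 2 : ℝ)) (c : ℝ × ℝ)
    {F : ℝ × ℝ → ℝ} (hF : AEStronglyMeasurable F volume) :
    eLpNorm (fun p => F ((1 - ε) • p + ε • c)) 2 volume ≤ 2 * eLpNorm F 2 volume := by
  have h0 : 1 - ε ≠ 0 := by have := hε.2; linarith
  have hmap : Measure.map (fun p : ℝ × ℝ => (1 - ε) • p + ε • c) volume =
      ENNReal.ofReal |((1 - ε) ^ 2)⁻¹| • volume := by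
    have h1 : (fun p : ℝ × ℝ => (1 - ε) • p + ε • c) =
        (fun p => p + ε • c) ∘ fun p => (1 - ε) • p := rfl
    rw [h1, ← Measure.map_map (by fun_prop) (by fun_prop)]
    have h2 := Measure.map_addHaar_smul (volume : Measure (ℝ × ℝ)) h0
    simp only [Module.finrank_prod, Module.finrank_self] at h2
    change Measure.map _ (Measure.map ((1 - ε) • ·) volume) = _
    rw [h2, Measure.map_smul, map_add_right_eq_self]
  have hF' : AEStronglyMeasurable F
      (Measure.map (fun p : ℝ × ℝ => (1 - ε) • p + ε • c) volume) := by
    rw [hmap]; exact hF.smul_measure _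
  have h := eLpNorm_map_measure (p := 2) hF' (by fun_prop)
  rw [Function.comp_def] at h
  rw [← h, hmap, eLpNorm_smul_measure_of_ne_top (by norm_num), smul_eq_mul]
  gcongr
  have h4 : |((1 - ε) ^ 2)⁻¹| ≤ 4 := by
    rw [abs_of_nonneg (by positivity), inv_le_comm₀ (by positivity) (by norm_num)]
    have := hε.2
    nlinarith
  calc _ ≤ ENNReal.ofReal 4 ^ (1 / (2 : ℝ≥0∞)).toReal :=
        ENNReal.rpow_le_rpow (ENNReal.ofReal_le_ofReal h4) (by positivity)
    _ = 2 := by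
      rw [ENNReal.ofReal_rpow_of_pos (by norm_num)]
      have : (4 : ℝ) ^ (1 / (2 : ℝ≥0∞)).toReal = 2 := by
        rw [show (4 : ℝ) = 2 ^ (2 : ℝ) by norm_num, ← Real.rpow_mul (by norm_num)]
        norm_num
      rw [this, ENNReal.ofReal_ofNat]

/-- Mollifying at a small scale and contracting slightly towards `c` changes an `L²` function little,
in the `L²` norm of a bounded set. -/
theorem tendsto_eLpNorm_mollify_sub {ε : ℕ → ℝ} (hε : ∀ n, ε n ∈ Ioc 0 (1 / 2 : ℝ))
    (hε0 : Tendsto ε atTop (𝓝 0)) (ρ : ℕ → ContDiffBump (0 : ℝ × ℝ))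
    (hρ : Tendsto (fun n => (ρ n).rOut) atTop (𝓝 0)) (c : ℝ × ℝ) {U : Set (ℝ × ℝ)}
    (hU : MeasurableSet U) (hUb : Bornology.IsBounded U) {F : ℝ × ℝ → ℝ} (hF : MemLp F 2 volume) :
    Tendsto (fun n => eLpNorm (fun p => ((ρ n).normed volume ⋆[lsmul ℝ ℝ, volume] F)
      ((1 - ε n) • p + ε n • c) - F p) 2 (volume.restrict U)) atTop (𝓝 0) := by
  obtain ⟨M, hM⟩ := hUb.exists_norm_le
  have hUfin : volume U ≠ ⊤ := hUb.measure_lt_top.ne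
  rw [ENNReal.tendsto_nhds_zero]
  intro η hη
  obtain ⟨η', hη'0, hη'⟩ : ∃ η' : ℝ≥0∞, η' ≠ 0 ∧ 4 * η' ≤ η :=
    ⟨η / 4, by simpa using hη.ne', (ENNReal.mul_div_cancel (by norm_num) (by norm_num)).le⟩
  obtain ⟨f, hfs, hfF, hfc, hfL⟩ := hF.exists_hasCompactSupport_eLpNorm_sub_le (by norm_num) hη'0
  -- a uniform error at most `a` is an `L²` error at most `η'` on `U`, which has finite measure
  obtain ⟨a, ha0, ha⟩ : ∃ a : ℝ, 0 < a ∧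
      ENNReal.ofReal a * volume U ^ (1 / (2 : ℝ≥0∞).toReal) ≤ η' := by
    have hV : volume U ^ (1 / (2 : ℝ≥0∞).toReal) ≠ ⊤ :=
      ENNReal.rpow_ne_top_of_nonneg (by positivity) hUfin
    have ht : Tendsto (fun a : ℝ => ENNReal.ofReal a * volume U ^ (1 / (2 : ℝ≥0∞).toReal))
        (𝓝[>] 0) (𝓝 0) := by
      have h1 : Tendsto (fun a : ℝ => ENNReal.ofReal a) (𝓝[>] 0) (𝓝 0) := by
        have := (ENNReal.continuous_ofReal.tendsto (0 : ℝ)).mono_left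
          (nhdsWithin_le_nhds (s := Ioi 0))
        simpa using this
      simpa using ENNReal.Tendsto.mul_const h1 (Or.inr hV)
    obtain ⟨a, h1, h2⟩ := ((ENNReal.tendsto_nhds_zero.1 ht η'
      (pos_iff_ne_zero.2 hη'0)).and self_mem_nhdsWithin).exists
    exact ⟨a, h2, h1⟩
  obtain ⟨δ, hδ, hfδ⟩ := Metric.uniformContinuous_iff.1
    (hfs.uniformContinuous_of_continuous hfc) a ha0
  have hsmall : ∀ᶠ n in atTop, ε n * (M + ‖c‖) + (ρ n).rOut < δ := by
    have : Tendsto (fun n => ε n * (M + ‖c‖) + (ρ n).rOut) atTop (𝓝 0) := by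
      simpa using (hε0.mul_const (M + ‖c‖)).add hρ
    exact this.eventually (gt_mem_nhds hδ)
  filter_upwards [hsmall] with n hn
  set k := (ρ n).normed (volume : Measure (ℝ × ℝ)) with hk
  set A : ℝ × ℝ → ℝ × ℝ := fun p => (1 - ε n) • p + ε n • c with hA
  have hAm : Continuous A := by fun_prop
  have hkint : HasCompactSupport k := (ρ n).hasCompactSupport_normed
  have hFloc : LocallyIntegrable F volume := hF.locallyIntegrable (by norm_num)
  have hfloc : LocallyIntegrable f volume := hfc.locallyIntegrable
  have hkc : Continuous k := (ρ n).continuous_normed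
  have hsplit : (fun p => (k ⋆[lsmul ℝ ℝ, volume] F) (A p) - F p) =
      (fun p => (k ⋆[lsmul ℝ ℝ, volume] (F - f)) (A p)) +
        ((fun p => (k ⋆[lsmul ℝ ℝ, volume] f) (A p) - f p) + (f - F)) := by
    have hadd : (k ⋆[lsmul ℝ ℝ, volume] F) =
        (k ⋆[lsmul ℝ ℝ, volume] (F - f)) + (k ⋆[lsmul ℝ ℝ, volume] f) := by
      conv_lhs => rw [← sub_add_cancel F f]
      exact ConvolutionExists.distrib_add
        (hkint.convolutionExists_left _ hkc (hFloc.sub hfloc))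
        (hkint.convolutionExists_left _ hkc hfloc)
    funext p
    simp only [hadd, Pi.add_apply, Pi.sub_apply]
    ring
  have hconv : Continuous (k ⋆[lsmul ℝ ℝ, volume] (F - f)) :=
    hkint.continuous_convolution_left _ hkc (hFloc.sub hfloc)
  have hconvf : Continuous (k ⋆[lsmul ℝ ℝ, volume] f) :=
    hkint.continuous_convolution_left _ hkc hfloc
  have e1 : eLpNorm (fun p => (k ⋆[lsmul ℝ ℝ, volume] (F - f)) (A p)) 2 (volume.restrict U) ≤
      2 * η' := by
    calc _ ≤ eLpNorm (fun p => (k ⋆[lsmul ℝ ℝ, volume] (F - f)) (A p)) 2 volume :=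
          eLpNorm_mono_measure _ Measure.restrict_le_self
      _ ≤ 2 * eLpNorm (k ⋆[lsmul ℝ ℝ, volume] (F - f)) 2 volume :=
          eLpNorm_comp_contraction_le (hε n) c hconv.aestronglyMeasurable
      _ ≤ 2 * eLpNorm (F - f) 2 volume := by
          gcongr
          exact eLpNorm_bump_convolution_le _ (hF.sub hfL).aestronglyMeasurable
      _ ≤ _ := by gcongr
  have e2 : eLpNorm (fun p => (k ⋆[lsmul ℝ ℝ, volume] f) (A p) - f p) 2 (volume.restrict U) ≤
      η' := by
    have hb : ∀ᵐ p ∂(volume.restrict U), ‖(k ⋆[lsmul ℝ ℝ, volume] f) (A p) - f p‖ ≤ a := by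
      refine ae_restrict_of_forall_mem hU fun p hp => ?_
      rw [← dist_eq_norm]
      refine dist_convolution_le ha0.le (ρ n).support_normed_eq.subset (ρ n).nonneg_normed
        (ρ n).integral_normed hfc.aestronglyMeasurable fun y hy => (hfδ ?_).le
      have h1 : dist (A p) p ≤ ε n * (M + ‖c‖) := by
        have : A p - p = ε n • (c - p) := by simp only [hA]; module
        rw [dist_eq_norm, this, norm_smul, Real.norm_of_nonneg (hε n).1.le]
        have := (hε n).1.le
        gcongr
        exact (norm_sub_le _ _).trans (by linarith [hM p hp])
      exact (dist_triangle y (A p) p).trans_lt (by linarith [Metric.mem_ball.1 hy])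
    have h := eLpNorm_le_of_ae_bound (p := 2) hb
    rw [Measure.restrict_apply_univ, mul_comm, ← one_div] at h
    exact h.trans ha
  have e3 : eLpNorm (f - F) 2 (volume.restrict U) ≤ η' := by
    rw [eLpNorm_sub_comm]
    exact (eLpNorm_mono_measure _ Measure.restrict_le_self).trans hfF
  have hfF' : AEStronglyMeasurable (f - F) (volume.restrict U) :=
    (hfL.sub hF).aestronglyMeasurable.restrict
  have m1 : AEStronglyMeasurable (fun p => (k ⋆[lsmul ℝ ℝ, volume] (F - f)) (A p))
      (volume.restrict U) := (hconv.comp hAm).aestronglyMeasurable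
  have m2 : AEStronglyMeasurable (fun p => (k ⋆[lsmul ℝ ℝ, volume] f) (A p) - f p)
      (volume.restrict U) := ((hconvf.comp hAm).sub hfc).aestronglyMeasurable
  rw [hsplit]
  calc _ ≤ _ := eLpNorm_add_le m1 (m2.add hfF') (by norm_num)
    _ ≤ _ := add_le_add_right (eLpNorm_add_le m2 hfF' (by norm_num)) _
    _ ≤ 2 * η' + (η' + η') := add_le_add e1 (add_le_add e2 e3)
    _ = 4 * η' := by ring
    _ ≤ η := hη'

/-! ### Density of smooth functions in `H¹` of the half disc -/

theorem convex_halfDisc (R : ℝ) : Convex ℝ (halfDisc R) := by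
  rintro ⟨x, y⟩ ⟨h1, h2⟩ ⟨x', y'⟩ ⟨h1', h2'⟩ a b ha hb hab
  simp only at h1 h2 h1' h2'
  have hb' : b = 1 - a := by linarith
  refine ⟨?_, ?_⟩
  · simp only [Prod.smul_mk, Prod.mk_add_mk, smul_eq_mul]
    have e : (a * x + b * x') ^ 2 + (a * y + b * y') ^ 2 =
        a * (x ^ 2 + y ^ 2) + b * (x' ^ 2 + y' ^ 2) - a * b * ((x - x') ^ 2 + (y - y') ^ 2) := by
      subst hb'; ring
    have h3 : 0 ≤ a * b * ((x - x') ^ 2 + (y - y') ^ 2) := by positivity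
    rcases ha.eq_or_lt with h | h
    · have : b = 1 := by linarith
      subst h this; linarith
    · have h4 : a * (x ^ 2 + y ^ 2) < a * R ^ 2 := by gcongr
      have h5 : b * (x' ^ 2 + y' ^ 2) ≤ b * R ^ 2 := by gcongr
      have h6 : a * R ^ 2 + b * R ^ 2 = R ^ 2 := by rw [← add_mul, hab, one_mul]
      linarith
  · simp only [Prod.smul_mk, Prod.mk_add_mk, smul_eq_mul]
    rcases ha.eq_or_lt with h | h
    · have : b = 1 := by linarith
      subst h this; linarith
    · positivity

theorem isBounded_halfDisc (R : ℝ) : Bornology.IsBounded (halfDisc R) := by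
  refine (Metric.isBounded_closedBall (x := (0 : ℝ × ℝ)) (r := |R|)).subset ?_
  rintro ⟨x, y⟩ ⟨h1, h2⟩
  simp only at h1
  rw [mem_closedBall_zero_iff, Prod.norm_mk, Real.norm_eq_abs, Real.norm_eq_abs]
  exact max_le (sq_le_sq.1 (by nlinarith)) (sq_le_sq.1 (by nlinarith))

theorem closedBall_subset_halfDisc {R : ℝ} (hR : 0 < R) :
    Metric.closedBall ((0, R / 2) : ℝ × ℝ) (R / 4) ⊆ halfDisc R := by
  rintro ⟨x, y⟩ h
  rw [Metric.mem_closedBall, Prod.dist_eq, max_le_iff, Real.dist_eq, Real.dist_eq] at h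
  simp only [sub_zero] at h
  obtain ⟨h1, h2⟩ := h
  rw [abs_le] at h1 h2
  refine ⟨?_, ?_⟩ <;> simp only <;> nlinarith

/-- Contracting a point of a convex set towards the centre of a ball contained in it yields a point
at a definite distance from the complement. -/
theorem Convex.closedBall_contraction_subset {E : Type*} [NormedAddCommGroup E] [NormedSpace ℝ E]
    {U : Set E} (hU : Convex ℝ U) {c : E} {d : ℝ} (hc : Metric.closedBall c d ⊆ U) {ε : ℝ}
    (hε : ε ∈ Ioc (0 : ℝ) 1) {p : E} (hp : p ∈ U) :
    Metric.closedBall ((1 - ε) • p + ε • c) (ε * d) ⊆ U := by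
  intro y hy
  set z : E := y - ((1 - ε) • p + ε • c) with hz
  have hzn : ‖z‖ ≤ ε * d := by rw [hz, ← dist_eq_norm]; exact hy
  have hw : c + ε⁻¹ • z ∈ U := by
    apply hc
    rw [Metric.mem_closedBall, dist_eq_norm, add_sub_cancel_left, norm_smul, norm_inv,
      Real.norm_of_nonneg hε.1.le, inv_mul_le_iff₀ hε.1]
    exact hzn
  have h := hU hp hw (by linarith [hε.2] : (0 : ℝ) ≤ 1 - ε) hε.1.le (by ring)
  rw [smul_add, smul_inv_smul₀ hε.1.ne', ← add_assoc, hz] at h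
  simpa using h

/-- At points whose distance to the complement exceeds the radius of the bump function, the
derivative of a mollification is the mollification of the weak derivative. -/
theorem fderiv_mollify_of_weak {U : Set (ℝ × ℝ)} (hU : MeasurableSet U) {h gv : ℝ × ℝ → ℝ}
    {v : ℝ × ℝ} (hh : MemLp h 2 (volume.restrict U))
    (hw : ∀ φ : ℝ × ℝ → ℝ, ContDiff ℝ ∞ φ → HasCompactSupport φ → tsupport φ ⊆ U →
      ∫ p in U, h p * fderiv ℝ φ p v = -∫ p in U, gv p * φ p)
    (ρ : ContDiffBump (0 : ℝ × ℝ)) {q : ℝ × ℝ} (hq : Metric.closedBall q ρ.rOut ⊆ U) :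
    fderiv ℝ (ρ.normed volume ⋆[lsmul ℝ ℝ, volume] U.indicator h) q v =
      (ρ.normed volume ⋆[lsmul ℝ ℝ, volume] U.indicator gv) q := by
  set k := ρ.normed (volume : Measure (ℝ × ℝ)) with hk
  have hH : LocallyIntegrable (U.indicator h) volume :=
    ((memLp_indicator_iff_restrict hU).2 hh).locallyIntegrable (by norm_num)
  have hkd : ContDiff ℝ ∞ k := ρ.contDiff_normed
  have hks : HasCompactSupport k := ρ.hasCompactSupport_normed
  have hkd1 : ContDiff ℝ 1 k := hkd.of_le (by exact_mod_cast le_top)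
  rw [← convolution_flip,
    (hks.hasFDerivAt_convolution_right (lsmul ℝ ℝ).flip hH hkd1 q).fderiv,
    convolution_precompR_apply _ hH (hks.fderiv ℝ) (hkd1.continuous_fderiv one_ne_zero)]
  have hflip : (k ⋆[lsmul ℝ ℝ, volume] U.indicator gv) =
      (U.indicator gv ⋆[(lsmul ℝ ℝ).flip, volume] k) := (convolution_flip _).symm
  rw [hflip]
  simp only [convolution_def, ContinuousLinearMap.flip_apply, ContinuousLinearMap.lsmul_apply,
    smul_eq_mul]
  -- the test function is the bump function reflected and centred at `q`
  have hsub : ∀ y, HasFDerivAt (fun y => k (q - y))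
      ((fderiv ℝ k (q - y)).comp (-ContinuousLinearMap.id ℝ (ℝ × ℝ))) y := fun y =>
    (hkd1.differentiable one_ne_zero _).hasFDerivAt.comp y ((hasFDerivAt_id y).const_sub q)
  have hts : tsupport (fun y => k (q - y)) ⊆ Metric.closedBall q ρ.rOut := by
    refine closure_minimal (fun y hy => ?_) Metric.isClosed_closedBall
    have : q - y ∈ Function.support k := hy
    rw [hk, ρ.support_normed_eq, mem_ball_zero_iff] at this
    rw [Metric.mem_closedBall, dist_comm, dist_eq_norm]
    exact this.le
  have key := hw (fun y => k (q - y)) (hkd.comp (contDiff_const.sub contDiff_id))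
    (HasCompactSupport.of_support_subset_isCompact (isCompact_closedBall q ρ.rOut)
      ((subset_tsupport _).trans hts)) (hts.trans hq)
  simp only [fun y => (hsub y).fderiv, ContinuousLinearMap.comp_apply,
    neg_apply, ContinuousLinearMap.id_apply, map_neg, mul_neg,
    integral_neg, neg_inj] at key
  rw [← integral_indicator hU, ← integral_indicator hU] at key
  have e : ∀ (f w : ℝ × ℝ → ℝ), (fun t => w t * U.indicator f t) =
      U.indicator fun t => f t * w t := fun f w => by
    funext t
    by_cases ht : t ∈ U <;> simp [ht, mul_comm]
  rw [e h fun t => fderiv ℝ k (q - t) v, e gv fun t => k (q - t)]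
  exact key

theorem tendsto_eLpNorm_const_mul_sub {α : Type*} [MeasurableSpace α] {μ : Measure α}
    {a : ℕ → ℝ} (ha : Tendsto a atTop (𝓝 1)) {f : ℕ → α → ℝ} {g : α → ℝ} (hg : MemLp g 2 μ)
    (hf : ∀ n, AEStronglyMeasurable (f n) μ)
    (hfg : Tendsto (fun n => eLpNorm (fun p => f n p - g p) 2 μ) atTop (𝓝 0)) :
    Tendsto (fun n => eLpNorm (fun p => a n * f n p - g p) 2 μ) atTop (𝓝 0) := by
  have hlim : Tendsto (fun n => ‖a n‖ₑ * eLpNorm (fun p => f n p - g p) 2 μ +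
      ‖a n - 1‖ₑ * eLpNorm g 2 μ) atTop (𝓝 0) := by
    have h1 : Tendsto (fun n => ‖a n‖ₑ) atTop (𝓝 ‖(1 : ℝ)‖ₑ) :=
      (continuous_enorm.tendsto _).comp ha
    have h2 : Tendsto (fun n => ‖a n - 1‖ₑ) atTop (𝓝 ‖(1 : ℝ) - 1‖ₑ) :=
      (continuous_enorm.tendsto _).comp (ha.sub_const 1)
    have h3 := (ENNReal.Tendsto.mul h1 (Or.inr (by simp)) hfg (Or.inr (by simp))).add
      (ENNReal.Tendsto.mul_const h2 (Or.inr hg.eLpNorm_ne_top))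
    simpa using h3
  refine tendsto_of_tendsto_of_tendsto_of_le_of_le tendsto_const_nhds hlim
    (fun _ => zero_le) fun n => ?_
  have e : (fun p => a n * f n p - g p) = a n • (fun p => f n p - g p) + (a n - 1) • g := by
    funext p
    simp only [Pi.add_apply, Pi.smul_apply, smul_eq_mul]; ring
  change eLpNorm (fun p => a n * f n p - g p) 2 μ ≤ _
  rw [e]
  refine (eLpNorm_add_le (((hf n).sub hg.aestronglyMeasurable).const_smul _)
    (hg.aestronglyMeasurable.const_smul _) (by norm_num)).trans ?_
  exact add_le_add (eLpNorm_const_smul_le) (eLpNorm_const_smul_le)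

/-- Functions that are smooth in the whole plane are dense in `H¹` of the half disc. -/
theorem exists_contDiff_tendstoInH1 {R : ℝ} (hR : 0 < R) {h : ℝ × ℝ → ℝ} {g : ℝ × ℝ → ℝ × ℝ}
    (hg : IsH1WithGradient (halfDisc R) h g) :
    ∃ φ : ℕ → ℝ × ℝ → ℝ, (∀ n, ContDiff ℝ ∞ (φ n)) ∧ TendstoInH1 (halfDisc R) φ h g := by
  set U := halfDisc R with hUdef
  have hU : MeasurableSet U := measurableSet_halfDisc R
  set c : ℝ × ℝ := (0, R / 2) with hc
  set ε : ℕ → ℝ := fun n => 1 / ((n : ℝ) + 2) with hεdef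
  have hε : ∀ n, ε n ∈ Ioc 0 (1 / 2 : ℝ) := fun n => by
    refine ⟨by positivity, ?_⟩
    have : (0 : ℝ) ≤ n := n.cast_nonneg
    exact one_div_le_one_div_of_le (by norm_num) (by linarith)
  have hε0 : Tendsto ε atTop (𝓝 0) := by
    have := tendsto_const_div_atTop_nhds_zero_nat (1 : ℝ)
    have h2 := (tendsto_add_atTop_iff_nat 2).2 this
    simpa [hεdef] using h2
  set ρ : ℕ → ContDiffBump (0 : ℝ × ℝ) := fun n =>
    ⟨ε n * (R / 4) / 2, ε n * (R / 4), by have := (hε n).1; positivity,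
      half_lt_self (by have := (hε n).1; positivity)⟩ with hρdef
  have hρ : Tendsto (fun n => (ρ n).rOut) atTop (𝓝 0) := by
    simpa using hε0.mul_const (R / 4)
  set A : ℕ → ℝ × ℝ → ℝ × ℝ := fun n p => (1 - ε n) • p + ε n • c with hA
  set m : ℕ → (ℝ × ℝ → ℝ) → ℝ × ℝ → ℝ := fun n f =>
    (ρ n).normed volume ⋆[lsmul ℝ ℝ, volume] U.indicator f with hm
  have hLp : ∀ {f : ℝ × ℝ → ℝ}, MemLp f 2 (volume.restrict U) →
      MemLp (U.indicator f) 2 volume := fun hf => (memLp_indicator_iff_restrict hU).2 hf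
  have hsm : ∀ {f : ℝ × ℝ → ℝ}, MemLp f 2 (volume.restrict U) → ∀ n, ContDiff ℝ ∞ (m n f) :=
    fun hf n => (ρ n).hasCompactSupport_normed.contDiff_convolution_left _
      (ρ n).contDiff_normed ((hLp hf).locallyIntegrable (by norm_num))
  have hAs : ∀ n, ContDiff ℝ ∞ (A n) := fun n => by fun_prop
  have hconv : ∀ {f : ℝ × ℝ → ℝ}, MemLp f 2 (volume.restrict U) →
      Tendsto (fun n => eLpNorm (fun p => m n f (A n p) - f p) 2 (volume.restrict U))
        atTop (𝓝 0) := by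
    intro f hf
    refine (tendsto_eLpNorm_mollify_sub hε hε0 ρ hρ c hU (isBounded_halfDisc R) (hLp hf)).congr
      fun n => eLpNorm_congr_ae (ae_restrict_of_forall_mem hU fun p hp => ?_)
    simp only [indicator_of_mem hp]
    rfl
  have hder : ∀ {gv : ℝ × ℝ → ℝ} {v : ℝ × ℝ}, MemLp gv 2 (volume.restrict U) →
      (∀ φ : ℝ × ℝ → ℝ, ContDiff ℝ ∞ φ → HasCompactSupport φ → tsupport φ ⊆ U →
        ∫ p in U, h p * fderiv ℝ φ p v = -∫ p in U, gv p * φ p) →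
      Tendsto (fun n => eLpNorm (fun p => fderiv ℝ (fun p => m n h (A n p)) p v - gv p) 2
        (volume.restrict U)) atTop (𝓝 0) := by
    intro gv v hgv hw
    have h1 : Tendsto (fun n => 1 - ε n) atTop (𝓝 1) := by simpa using hε0.const_sub 1
    refine (tendsto_eLpNorm_const_mul_sub h1 hgv (fun n =>
      ((hsm hgv n).continuous.comp (hAs n).continuous).aestronglyMeasurable) (hconv hgv)).congr
      fun n => eLpNorm_congr_ae (ae_restrict_of_forall_mem hU fun p hp => ?_)
    have hball : Metric.closedBall (A n p) (ρ n).rOut ⊆ U :=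
      (convex_halfDisc R).closedBall_contraction_subset (closedBall_subset_halfDisc hR)
        ⟨(hε n).1, (hε n).2.trans (by norm_num)⟩ hp
    have hAd : HasFDerivAt (A n) ((1 - ε n) • ContinuousLinearMap.id ℝ (ℝ × ℝ)) p :=
      ((hasFDerivAt_id p).const_smul (1 - ε n)).add_const _
    have hcomp := (((hsm hg.memLp n).differentiable (by simp) (A n p)).hasFDerivAt.comp p
      hAd).fderiv
    have hF := fderiv_mollify_of_weak hU hg.memLp hw (ρ n) hball
    simp only [Function.comp_def] at hcomp
    simp only [hcomp, ContinuousLinearMap.comp_apply, smul_apply,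
      ContinuousLinearMap.id_apply, map_smul, smul_eq_mul]
    rw [show fderiv ℝ (m n h) (A n p) v = m n gv (A n p) from hF]
    rfl
  exact ⟨fun n p => m n h (A n p), fun n => (hsm hg.memLp n).comp (hAs n),
    hconv hg.memLp, hder hg.memLp_fst hg.weak_fst, hder hg.memLp_snd hg.weak_snd⟩

/-! ### The trace and its weighted estimate -/

theorem eLpNorm_trace_le {u : ℝ × ℝ → ℝ} (hu : ContDiff ℝ 1 u) {R : ℝ} (hR : 0 < R) :
    eLpNorm (fun x => u (x, 0)) 2 (volume.restrict (Ioo 0 R)) ≤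
      (ENNReal.ofReal (4 / R) * eLpNorm u 2 (volume.restrict (halfDisc R)) ^ 2 +
        ENNReal.ofReal R *
          (eLpNorm (fun p => fderiv ℝ u p (1, 0)) 2 (volume.restrict (halfDisc R)) +
            eLpNorm (fun p => fderiv ℝ u p (0, 1)) 2 (volume.restrict (halfDisc R))) ^ 2) ^
        (1 / 2 : ℝ) := by
  rw [eLpNorm_two_eq_rpow_half (volume.restrict (Ioo 0 R))]
  refine ENNReal.rpow_le_rpow ((lintegral_sq_trace_le hu hR).trans ?_) (by norm_num)
  rw [sq_eLpNorm_two]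
  gcongr
  rw [← sq_rpow_half (∫⁻ p in halfDisc R, gradSize u p ^ 2)]
  exact pow_le_pow_left' (rpow_half_lintegral_gradSize_sq_le hu _) 2

theorem tendsto_eLpNorm_sub_sub {α : Type*} [MeasurableSpace α] {μ : Measure α}
    {f : ℕ → α → ℝ} {g : α → ℝ} (hf : ∀ n, AEStronglyMeasurable (f n) μ)
    (hg : AEStronglyMeasurable g μ)
    (hfg : Tendsto (fun n => eLpNorm (fun p => f n p - g p) 2 μ) atTop (𝓝 0)) :
    Tendsto (fun n : ℕ × ℕ => eLpNorm (fun p => f n.1 p - f n.2 p) 2 μ) atTop (𝓝 0) := by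
  have h1 : Tendsto (fun n : ℕ × ℕ => eLpNorm (fun p => f n.1 p - g p) 2 μ +
      eLpNorm (fun p => f n.2 p - g p) 2 μ) atTop (𝓝 0) := by
    rw [← prod_atTop_atTop_eq]
    simpa using (hfg.comp tendsto_fst).add (hfg.comp tendsto_snd)
  refine tendsto_of_tendsto_of_tendsto_of_le_of_le tendsto_const_nhds h1
    (fun _ => zero_le) fun n => ?_
  have e : (fun p => f n.1 p - f n.2 p) = (fun p => f n.1 p - g p) - fun p => f n.2 p - g p := by
    funext p; simp
  change eLpNorm (fun p => f n.1 p - f n.2 p) 2 μ ≤ _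
  rw [e]
  exact eLpNorm_sub_le ((hf _).sub hg) ((hf _).sub hg) (by norm_num)

theorem aestronglyMeasurable_fderiv_apply {u : ℝ × ℝ → ℝ} (hu : ContDiff ℝ 1 u) (v : ℝ × ℝ)
    (μ : Measure (ℝ × ℝ)) : AEStronglyMeasurable (fun p => fderiv ℝ u p v) μ :=
  ((hu.continuous_fderiv one_ne_zero).clm_apply continuous_const).aestronglyMeasurable

/-- The trace exists: the restrictions to the axis of an approximating sequence are a Cauchy sequence
in `L²`. -/
theorem exists_isTraceOnPosAxis {R : ℝ} (hR : 0 < R) {h : ℝ × ℝ → ℝ} {g : ℝ × ℝ → ℝ × ℝ}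
    (hg : IsH1WithGradient (halfDisc R) h g) : ∃ t : ℝ → ℝ, IsTraceOnPosAxis R h g t := by
  obtain ⟨φ, hφ, hlim⟩ := exists_contDiff_tendstoInH1 hR hg
  have hφ1 : ∀ n, ContDiff ℝ 1 (φ n) := fun n => (hφ n).of_le (by exact_mod_cast le_top)
  set μ := volume.restrict (halfDisc R)
  set ν := volume.restrict (Ioo 0 R)
  have hT : ∀ n, MemLp (fun x => φ n (x, 0)) 2 ν := by
    intro n
    have hc : Continuous fun x : ℝ => φ n (x, 0) := (hφ n).continuous.comp (by fun_prop)
    obtain ⟨C, hC⟩ := isCompact_Icc.exists_bound_of_continuousOn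
      (hc.continuousOn (s := Icc 0 R))
    exact MemLp.of_bound hc.aestronglyMeasurable C
      (ae_restrict_of_forall_mem measurableSet_Ioo fun x hx => hC x (Ioo_subset_Icc_self hx))
  have hcauchy : Tendsto (fun n : ℕ × ℕ =>
      eLpNorm (fun x => φ n.1 (x, 0) - φ n.2 (x, 0)) 2 ν) atTop (𝓝 0) := by
    have h0 := tendsto_eLpNorm_sub_sub (fun n => (hφ n).continuous.aestronglyMeasurable)
      hg.memLp.aestronglyMeasurable hlim.fun_tendsto
    have h1 := tendsto_eLpNorm_sub_sub (fun n => aestronglyMeasurable_fderiv_apply (hφ1 n) _ μ)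
      hg.memLp_fst.aestronglyMeasurable hlim.fst_tendsto
    have h2 := tendsto_eLpNorm_sub_sub (fun n => aestronglyMeasurable_fderiv_apply (hφ1 n) _ μ)
      hg.memLp_snd.aestronglyMeasurable hlim.snd_tendsto
    have h3 := ((ENNReal.Tendsto.const_mul (ENNReal.Tendsto.pow (n := 2) h0)
      (Or.inr (ENNReal.ofReal_ne_top (r := 4 / R)))).add
      (ENNReal.Tendsto.const_mul (ENNReal.Tendsto.pow (n := 2) (h1.add h2))
      (Or.inr (ENNReal.ofReal_ne_top (r := R))))).ennrpow_const (1 / 2 : ℝ)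
    norm_num at h3
    refine tendsto_of_tendsto_of_tendsto_of_le_of_le tendsto_const_nhds h3
      (fun _ => zero_le) fun n => ?_
    have hd : ∀ p v, fderiv ℝ (fun p => φ n.1 p - φ n.2 p) p v =
        fderiv ℝ (φ n.1) p v - fderiv ℝ (φ n.2) p v := fun p v => by
      rw [fderiv_fun_sub ((hφ1 _).differentiable one_ne_zero p)
        ((hφ1 _).differentiable one_ne_zero p)]
      rfl
    have h4 := eLpNorm_trace_le ((hφ1 n.1).sub (hφ1 n.2)) hR
    simp only [hd] at h4
    norm_num at h4
    exact h4
  have hC : CauchySeq fun n => (hT n).toLp := by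
    rw [Lp.cauchySeq_Lp_iff_cauchySeq_eLpNorm]
    refine hcauchy.congr fun n => eLpNorm_congr_ae ?_
    filter_upwards [(hT n.1).coeFn_toLp, (hT n.2).coeFn_toLp] with x h1 h2
    simp [h1, h2]
  obtain ⟨t, ht⟩ := cauchySeq_tendsto_of_complete hC
  refine ⟨t, Lp.memLp t, φ, hφ, hlim, ?_⟩
  rw [Lp.tendsto_Lp_iff_tendsto_eLpNorm'] at ht
  refine ht.congr fun n => eLpNorm_congr_ae ?_
  filter_upwards [(hT n).coeFn_toLp] with x h1
  simp [h1]

theorem eLpNorm_le_sub_add {α : Type*} [MeasurableSpace α] {μ : Measure α}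
    {f g : α → ℝ} (hf : AEStronglyMeasurable f μ) (hg : AEStronglyMeasurable g μ) :
    eLpNorm f 2 μ ≤ eLpNorm (fun p => f p - g p) 2 μ + eLpNorm g 2 μ := by
  have e : f = (fun p => f p - g p) + g := by funext p; simp
  conv_lhs => rw [e]
  exact eLpNorm_add_le (hf.sub hg) hg (by norm_num)

/-- The weighted estimate for an arbitrary trace, by Fatou's lemma. -/
theorem IsTraceOnPosAxis.lintegral_inv_sqrt_mul_le {R : ℝ} (hR : 0 < R) {h : ℝ × ℝ → ℝ}
    {g : ℝ × ℝ → ℝ × ℝ} (hg : IsH1WithGradient (halfDisc R) h g) {t : ℝ → ℝ}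
    (ht : IsTraceOnPosAxis R h g t) :
    ∫⁻ x in Ioo 0 R, ENNReal.ofReal (√x)⁻¹ * ‖t x‖ₑ ≤
      2 * eLpNorm t 2 (volume.restrict (Ioo 0 R)) +
      5 * (ENNReal.ofReal R ^ (1 / 2 : ℝ) *
        (eLpNorm (fun p => (g p).1) 2 (volume.restrict (halfDisc R)) +
          eLpNorm (fun p => (g p).2) 2 (volume.restrict (halfDisc R)))) := by
  obtain ⟨φ, hφ, hlim, htr⟩ := ht.exists_approx
  have hφ1 : ∀ n, ContDiff ℝ 1 (φ n) := fun n => (hφ n).of_le (by exact_mod_cast le_top)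
  have hTm : ∀ n, Continuous fun x : ℝ => φ n (x, 0) := fun n =>
    (hφ n).continuous.comp (by fun_prop)
  obtain ⟨ns, hns, hae⟩ := (tendstoInMeasure_of_tendsto_eLpNorm (p := 2) (by norm_num)
    (fun n => (hTm n).aestronglyMeasurable) ht.memLp.aestronglyMeasurable
    htr).exists_seq_tendsto_ae
  set μ := volume.restrict (halfDisc R)
  set ν := volume.restrict (Ioo 0 R)
  have hRt : ENNReal.ofReal R ^ (1 / 2 : ℝ) ≠ ⊤ :=
    ENNReal.rpow_ne_top_of_nonneg (by norm_num) ENNReal.ofReal_ne_top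
  have hbound : ∀ n, ∫⁻ x in Ioo 0 R, ENNReal.ofReal (√x)⁻¹ * ‖φ n (x, 0)‖ₑ ≤
      2 * (eLpNorm (fun x => φ n (x, 0) - t x) 2 ν + eLpNorm t 2 ν) +
      5 * (ENNReal.ofReal R ^ (1 / 2 : ℝ) *
        ((eLpNorm (fun p => fderiv ℝ (φ n) p (1, 0) - (g p).1) 2 μ +
            eLpNorm (fun p => (g p).1) 2 μ) +
          (eLpNorm (fun p => fderiv ℝ (φ n) p (0, 1) - (g p).2) 2 μ +
            eLpNorm (fun p => (g p).2) 2 μ))) := by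
    intro n
    refine (lintegral_inv_sqrt_mul_trace_le (hφ1 n) hR).trans ?_
    gcongr
    · exact eLpNorm_le_sub_add (hTm n).aestronglyMeasurable ht.memLp.aestronglyMeasurable
    · exact eLpNorm_le_sub_add (aestronglyMeasurable_fderiv_apply (hφ1 n) _ μ)
        hg.memLp_fst.aestronglyMeasurable
    · exact eLpNorm_le_sub_add (aestronglyMeasurable_fderiv_apply (hφ1 n) _ μ)
        hg.memLp_snd.aestronglyMeasurable
  have hB := (ENNReal.Tendsto.const_mul (a := 2) (htr.add_const (eLpNorm t 2 ν))
    (Or.inr (by norm_num))).add (ENNReal.Tendsto.const_mul (a := 5)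
      (ENNReal.Tendsto.const_mul (a := ENNReal.ofReal R ^ (1 / 2 : ℝ))
      ((hlim.fst_tendsto.add_const (eLpNorm (fun p => (g p).1) 2 μ)).add
      (hlim.snd_tendsto.add_const (eLpNorm (fun p => (g p).2) 2 μ))) (Or.inr hRt))
      (Or.inr (by norm_num)))
  simp only [zero_add] at hB
  have hB' := hB.comp hns.tendsto_atTop
  calc ∫⁻ x in Ioo 0 R, ENNReal.ofReal (√x)⁻¹ * ‖t x‖ₑ
      = ∫⁻ x in Ioo 0 R, liminf
          (fun i => ENNReal.ofReal (√x)⁻¹ * ‖φ (ns i) (x, 0)‖ₑ) atTop := by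
        refine lintegral_congr_ae ?_
        filter_upwards [hae] with x hx
        exact (ENNReal.Tendsto.const_mul ((continuous_enorm.tendsto _).comp hx)
          (Or.inr ENNReal.ofReal_ne_top)).liminf_eq.symm
    _ ≤ liminf (fun i => ∫⁻ x in Ioo 0 R, ENNReal.ofReal (√x)⁻¹ * ‖φ (ns i) (x, 0)‖ₑ) atTop :=
        lintegral_liminf_le fun i =>
          (by fun_prop : Measurable fun x : ℝ => ENNReal.ofReal (√x)⁻¹).mul
            (hTm (ns i)).measurable.enorm
    _ ≤ _ := liminf_le_liminf (Eventually.of_forall fun i => hbound (ns i))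
    _ = _ := hB'.liminf_eq

theorem eLpNorm_two_eq_ofReal_sqrt {α : Type*} [MeasurableSpace α] {μ : Measure α} {f : α → ℝ}
    (hf : MemLp f 2 μ) : eLpNorm f 2 μ = ENNReal.ofReal √(∫ a, f a ^ 2 ∂μ) := by
  rw [hf.eLpNorm_eq_integral_rpow_norm (by norm_num) (by norm_num), Real.sqrt_eq_rpow]
  simp

theorem theorem4p2 :
    ∃ κ : ℝ, ∀ R : ℝ, 0 < R → ∀ (h : ℝ × ℝ → ℝ) (g : ℝ × ℝ → ℝ × ℝ),
      IsH1WithGradient (halfDisc R) h g →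
      (∃ t : ℝ → ℝ, IsTraceOnPosAxis R h g t) ∧
      ∀ t : ℝ → ℝ, IsTraceOnPosAxis R h g t →
        IntegrableOn (fun x : ℝ => x ^ (-(1 / 2) : ℝ) * |t x|) (Ioo 0 R) ∧
        ∫ x in Ioo 0 R, x ^ (-(1 / 2) : ℝ) * |t x| ≤
          κ * Real.sqrt (R * ∫ p in halfDisc R, ((g p).1 ^ 2 + (g p).2 ^ 2)) +
          κ * Real.sqrt (∫ x in Ioo 0 R, t x ^ 2) := by
  refine ⟨10, fun R hR h g hg => ⟨exists_isTraceOnPosAxis hR hg, fun t ht => ?_⟩⟩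
  set E := ∫ p in halfDisc R, ((g p).1 ^ 2 + (g p).2 ^ 2) with hE
  set T := ∫ x in Ioo 0 R, t x ^ 2 with hT
  have hi1 := hg.memLp_fst.integrable_sq
  have hi2 := hg.memLp_snd.integrable_sq
  have hE1 : ∫ p in halfDisc R, (g p).1 ^ 2 ≤ E :=
    integral_mono hi1 (hi1.add hi2) fun p => by simp [sq_nonneg]
  have hE2 : ∫ p in halfDisc R, (g p).2 ^ 2 ≤ E :=
    integral_mono hi2 (hi1.add hi2) fun p => by simp [sq_nonneg]
  have hK : ∫⁻ x in Ioo 0 R, ENNReal.ofReal (√x)⁻¹ * ‖t x‖ₑ ≤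
      ENNReal.ofReal (2 * √T + 10 * √(R * E)) := by
    refine (ht.lintegral_inv_sqrt_mul_le hR hg).trans ?_
    rw [eLpNorm_two_eq_ofReal_sqrt ht.memLp, eLpNorm_two_eq_ofReal_sqrt hg.memLp_fst,
      eLpNorm_two_eq_ofReal_sqrt hg.memLp_snd, ENNReal.ofReal_rpow_of_pos hR,
      ← Real.sqrt_eq_rpow, ← ENNReal.ofReal_add (by positivity) (by positivity),
      ← ENNReal.ofReal_mul (by positivity), ← ENNReal.ofReal_ofNat 2, ← ENNReal.ofReal_ofNat 5,
      ← ENNReal.ofReal_mul (by positivity), ← ENNReal.ofReal_mul (by positivity),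
      ← ENNReal.ofReal_add (by positivity) (by positivity)]
    refine ENNReal.ofReal_le_ofReal ?_
    rw [Real.sqrt_mul hR.le]
    have h1 := mul_le_mul_of_nonneg_left (Real.sqrt_le_sqrt hE1) (Real.sqrt_nonneg R)
    have h2 := mul_le_mul_of_nonneg_left (Real.sqrt_le_sqrt hE2) (Real.sqrt_nonneg R)
    linarith
  have hw : ∀ x ∈ Ioo 0 R, ‖x ^ (-(1 / 2) : ℝ) * |t x|‖ₑ =
      ENNReal.ofReal (√x)⁻¹ * ‖t x‖ₑ := fun x hx => by
    rw [enorm_mul, Real.rpow_neg hx.1.le, ← Real.sqrt_eq_rpow,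
      Real.enorm_of_nonneg (inv_nonneg.2 (Real.sqrt_nonneg x)), Real.enorm_abs]
  have hL := setLIntegral_congr_fun (μ := volume) measurableSet_Ioo hw
  have hint : IntegrableOn (fun x : ℝ => x ^ (-(1 / 2) : ℝ) * |t x|) (Ioo 0 R) := by
    refine ⟨AEStronglyMeasurable.mul (by fun_prop) ht.memLp.aestronglyMeasurable.norm, ?_⟩
    rw [hasFiniteIntegral_iff_enorm, hL]
    exact hK.trans_lt ENNReal.ofReal_lt_top
  refine ⟨hint, ?_⟩
  have h1 : ENNReal.ofReal (∫ x in Ioo 0 R, x ^ (-(1 / 2) : ℝ) * |t x|) ≤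
      ENNReal.ofReal (2 * √T + 10 * √(R * E)) := by
    refine le_trans (Real.ofReal_le_enorm _) ?_
    exact (enorm_integral_le_lintegral_enorm _).trans (hL.trans_le hK)
  have h2 := (ENNReal.ofReal_le_ofReal_iff (by positivity)).1 h1
  linarith [Real.sqrt_nonneg T]
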